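/- Let $q$ be a prime power, let $\ell, m$ be integers with $1\le \ell<m$, and let $V$ be an $m$-dimensional vector space over $\mathbb{F}_q$; identify $\bigwedge^m V$ with $\mathbb{F}_q$ by means of a fixed basis of $V$. Let $A_1\subset\cdots\subset A_\ell$ be a strictly increasing sequence of nonzero subspaces of $V$, put $\alpha_i=\dim A_i$ and $\alpha=(\alpha_1,\dots,\alpha_\ell)$, and let $$\Omega_\alpha(\ell,m)=\{L\subseteq V \text{ a subspace} : \dim L=\ell \text{ and } \dim(L\cap A_i)\ge i \text{ for all } i=1,\dots,\ell\}.$$ Let $L_1,\dots,L_n$ be an enumeration of $\Omega_\alpha(\ell,m)$ without repetition, and for each $j$ fix a nonzero element $P_j=v_\ell\wedge\cdots\wedge v_1\in\bigwedge^\ell V$ with $v_i\in A_i$ for $i=1,\dots,\ell$ and $L_j=\{x\in V: P_j\wedge x=0\}$. For $f\in\bigwedge^{m-\ell}V$ put $c_f=(f\wedge P_1,\dots,f\wedge P_n)\in\mathbb{F}_q^n$, and let the Schubert code be $C_\alpha(\ell,m)=\{c_f: f\in\bigwedge^{m-\ell}V\}$. A minimum weight codeword of $C_\alpha(\ell,m)$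 is a codeword whose Hamming weight equals the least Hamming weight of a nonzero codeword. An element $h\in\bigwedge^{m-\ell}V$ is called decomposable if $h\neq0$ and $h=h_1\wedge\cdots\wedge h_{m-\ell}$ for some $h_1,\dots,h_{m-\ell}\in V$. **Theorem.** Suppose that $\alpha$ is completely non-consecutive, i.e. $\alpha_i-\alpha_{i-1}\ge 2$ for $1<i\le\ell$. If $c$ is a minimum weight codeword of $C_\alpha(\ell,m)$, then $c=c_h$ for some decomposable $h\in\bigwedge^{m-\ell}V$. -/

import Mathlib

/-- The minimum distance of a linear code `C ⊆ F^n`: the least Hamming weight of a nonzero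
codeword. -/
noncomputable def minDistance {F : Type*} [Field F] [DecidableEq F] {n : ℕ}
    (C : Submodule F (Fin n → F)) : ℕ :=
  sInf {w : ℕ | ∃ c ∈ C, c ≠ 0 ∧ hammingNorm c = w}

/-- A minimum weight codeword of `C`: a codeword whose Hamming weight is the minimum distance. -/
def IsMinWeightCodeword {F : Type*} [Field F] [DecidableEq F] {n : ℕ}
    (C : Submodule F (Fin n → F)) (c : Fin n → F) : Prop :=
  c ∈ C ∧ hammingNorm c = minDistance C

/-- An element of `⋀^d V` is decomposable if it is nonzero and of the form `f₁ ∧ ⋯ ∧ f_d`. -/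
def IsDecomposable {F V : Type*} [Field F] [AddCommGroup V] [Module F V] {d : ℕ}
    (f : ⋀[F]^d V) : Prop :=
  f ≠ 0 ∧ ∃ v : Fin d → V, f = exteriorPower.ιMulti F d v

/-- The annihilator `V_f = {x ∈ V : f ∧ x = 0}` of `f ∈ ⋀^d V`. -/
noncomputable def wedgeAnnihilator {F V : Type*} [Field F] [AddCommGroup V] [Module F V] {d : ℕ}
    (f : ⋀[F]^d V) : Submodule F V :=
  LinearMap.ker
    ((LinearMap.mulLeft F (f : ExteriorAlgebra F V)).comp (ExteriorAlgebra.ι F))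

/-- A partial flag `A₁ ⊂ ⋯ ⊂ A_ℓ` of nonzero subspaces (all inclusions strict); the subspace
called `A i` with `i : Fin ℓ` is the one whose usual index is `i + 1`. -/
def IsPartialFlag {F V : Type*} [Field F] [AddCommGroup V] [Module F V] {ℓ : ℕ}
    (A : Fin ℓ → Submodule F V) : Prop :=
  StrictMono A ∧ ∀ i, A i ≠ ⊥

/-- The dimension sequence `α` of a partial flag. -/
noncomputable def dimSeq {F V : Type*} [Field F] [AddCommGroup V] [Module F V] {ℓ : ℕ}
    (A : Fin ℓ → Submodule F V) (i : Fin ℓ) : ℕ :=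
  Module.finrank F (A i)

/-- `α` is completely non-consecutive if consecutive entries differ by at least `2`. -/
def CompletelyNonConsecutive {ℓ : ℕ} (α : Fin ℓ → ℕ) : Prop :=
  ∀ i j : Fin ℓ, (j : ℕ) = i + 1 → α i + 2 ≤ α j

/-- The Schubert variety `Ω_α(ℓ, m)` of the partial flag `A`: the `ℓ`-dimensional subspaces `L`
of `V` such that `dim (L ∩ A_i) ≥ i` for `i = 1, …, ℓ`. -/
def schubertVariety {F V : Type*} [Field F] [AddCommGroup V] [Module F V] {ℓ : ℕ}
    (A : Fin ℓ → Submodule F V) : Set (Submodule F V) :=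
  {L | Module.finrank F L = ℓ ∧
    ∀ i : Fin ℓ, (i : ℕ) + 1 ≤ Module.finrank F (L ⊓ A i : Submodule F V)}

/-- `P ∈ ⋀^ℓ V` is an admissible representative of `L ∈ Ω_α(ℓ, m)`: it is decomposable of the form
`v_ℓ ∧ ⋯ ∧ v₁` with `v_i ∈ A_i` for all `i`, and `V_P = L`. -/
def IsSchubertRepresentative {F V : Type*} [Field F] [AddCommGroup V] [Module F V] {ℓ : ℕ}
    (A : Fin ℓ → Submodule F V) (L : Submodule F V) (P : ⋀[F]^ℓ V) : Prop :=
  P ≠ 0 ∧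
    (∃ v : Fin ℓ → V, (∀ i, v i ∈ A i) ∧ P = exteriorPower.ιMulti F ℓ (fun i => v i.rev)) ∧
    wedgeAnnihilator P = L

/-- The identification of `⋀^m V` with `F` given by a basis `b` of `V`; it sends
`b₁ ∧ ⋯ ∧ b_m` to `1`. -/
noncomputable def topIdentification {F V : Type*} [Field F] [AddCommGroup V] [Module F V] {m : ℕ}
    (b : Module.Basis (Fin m) F V) : ⋀[F]^m V →ₗ[F] F :=
  exteriorPower.alternatingMapLinearEquiv b.det

/-- The map `f ↦ f ∧ P` from `⋀^(m-ℓ) V` to `⋀^m V`, for `P ∈ ⋀^ℓ V`; the product is that of the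
exterior algebra. -/
noncomputable def wedgeRight {F V : Type*} [Field F] [AddCommGroup V] [Module F V] {ℓ m : ℕ}
    (h : ℓ ≤ m) (P : ⋀[F]^ℓ V) : ⋀[F]^(m - ℓ) V →ₗ[F] ⋀[F]^m V where
  toFun f := ⟨(f : ExteriorAlgebra F V) * P, by
    have hmem := SetLike.mul_mem_graded (A := fun i : ℕ => ⋀[F]^i V) f.2 P.2
    rwa [Nat.sub_add_cancel h] at hmem⟩
  map_add' f g := by
    ext
    simp [add_mul]
  map_smul' a f := by
    ext
    simp

/-- The evaluation map `f ↦ c_f = (f ∧ P₁, …, f ∧ P_n)`, where `⋀^m V` is identified with `F` by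
means of the basis `b`. -/
noncomputable def schubertEval {F V : Type*} [Field F] [AddCommGroup V] [Module F V] {ℓ m n : ℕ}
    (h : ℓ ≤ m) (b : Module.Basis (Fin m) F V) (P : Fin n → ⋀[F]^ℓ V) :
    ⋀[F]^(m - ℓ) V →ₗ[F] (Fin n → F) :=
  LinearMap.pi fun j => (topIdentification b).comp (wedgeRight h (P j))

/-- The Schubert code `C_α(ℓ, m)`: the image of the evaluation map. -/
noncomputable def schubertCode {F V : Type*} [Field F] [AddCommGroup V] [Module F V] {ℓ m n : ℕ}
    (h : ℓ ≤ m) (b : Module.Basis (Fin m) F V) (P : Fin n → ⋀[F]^ℓ V) :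
    Submodule F (Fin n → F) :=
  LinearMap.range (schubertEval h b P)

/-! To `f` belongs the alternating form `φ(u) = f ∧ u₁ ∧ ⋯ ∧ u_ℓ`. A subspace `L` of the Schubert
variety has a basis with one vector in each `A_i`, and whether `φ` vanishes on a basis depends only
on `L`. So the weight of `c_f` is the number of `L` detected by `φ` on the flag. The flag is read in
decreasing order `D 0 ⊃ D 1 ⊃ ⋯`. The claim becomes: a form detecting the least positive number of
subspaces agrees on flag tuples with a multiple of a product of linear forms.

The proof is by induction on the length of the flag. Put `A = D 0`, `a = dim A`, and let `B` be the
next member (or `⊥`). Counting pairs `(x, L)` with `x ∈ L ∖ B` expresses the number of detected `L ⊄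
B` through the numbers for the contractions `φ(x, ·)` on the shorter flag
(`sum_ncard_nonvanishing_curryLeft`). Let `K` be the set of `x ∈ A` whose contraction is zero there;
every `x ∉ B ∪ K` contributes at least the minimum `d'`. If `K` has codimension at least 2 in `A`,
so has `B`, by non-consecutiveness, and `|A ∖ (B ∪ K)| > q^a - q^(a-1)`, so `φ` is not minimal. If
`K` is a hyperplane, antisymmetry gives `B ≤ K` (`le_vanishingSubmodule`), and minimality of `φ`
makes every contraction outside `K` minimal. Then `φ = l ∧ φ(z, ·)` on the flag, with `l` the
coordinate along some `z ∉ K`, and induction factors `φ(z, ·)`.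

Finally, a nonzero multiple of a nonzero product of linear forms is the form of a decomposable
element, the wedge of a basis of the common kernel, suitably scaled. -/

open Module

/-! ### Alternating forms and the subspaces they detect. -/

section Forms

variable {F V : Type*} [Field F] [AddCommGroup V] [Module F V]

/-- An alternating form vanishing on a tuple vanishes on all tuples from its span. -/
theorem AlternatingMap.eq_zero_of_mem_span_range {k : ℕ} (φ : V [⋀^Fin k]→ₗ[F] F)
    {u v : Fin k → V} (hv : ∀ i, v i ∈ Submodule.span F (Set.range u)) (hu : φ u = 0) :
    φ v = 0 := by
  have hT : ∀ i, ∃ w : Fin k → F, Fintype.linearCombination F u w = v i := fun i => by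
    have := hv i
    rwa [← Fintype.range_linearCombination F] at this
  choose w hw using hT
  -- Pulled back to `F^k` along `u`, the form is a multiple of the determinant; the factor is its
  -- value `φ u` on the standard basis.
  have key := AlternatingMap.eq_smul_basis_det (Pi.basisFun F (Fin k))
    (φ.compLinearMap (Fintype.linearCombination F u))
  have h0 : (φ.compLinearMap (Fintype.linearCombination F u)) (Pi.basisFun F (Fin k)) = 0 := by
    rw [AlternatingMap.compLinearMap_apply, ← hu]
    congr 1
    ext i
    simp
  rw [h0, zero_smul] at key
  have := DFunLike.congr_fun key w
  rw [AlternatingMap.compLinearMap_apply] at this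
  rw [← show (fun i => Fintype.linearCombination F u (w i)) = v from funext hw]
  exact this

/-- Elements of the span of the other arguments may be dropped from the first argument. -/
theorem AlternatingMap.cons_add_smul_of_mem_span {k : ℕ} (φ : V [⋀^Fin (k + 1)]→ₗ[F] F)
    {u : Fin k → V} (a : F) (x : V) {y : V} (hy : y ∈ Submodule.span F (Set.range u)) :
    φ (Fin.cons (y + a • x) u) = a * φ (Fin.cons x u) := by
  have h0 : φ.curryLeft y u = 0 := by
    rw [AlternatingMap.curryLeft_apply_apply]
    apply φ.map_linearDependent
    rw [Matrix.vecCons, linearIndependent_finCons]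
    exact fun h => h.2 hy
  have : φ.curryLeft (y + a • x) u = a * φ.curryLeft x u := by
    simp only [map_add, map_smul, AlternatingMap.add_apply, AlternatingMap.smul_apply, h0,
      smul_eq_mul, zero_add]
  exact this

/-- The form `g₁ ∧ ⋯ ∧ g_k`, as the determinant of the values of the linear forms `g_j`. -/
noncomputable def wedgeForm {k : ℕ} (g : Fin k → V →ₗ[F] F) : V [⋀^Fin k]→ₗ[F] F :=
  Matrix.detRowAlternating.compLinearMap (LinearMap.pi g)

theorem wedgeForm_apply {k : ℕ} (g : Fin k → V →ₗ[F] F) (v : Fin k → V) :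
    wedgeForm g v = Matrix.det (Matrix.of fun i j => g j (v i)) := rfl

theorem wedgeForm_cons {k : ℕ} (g : Fin k → V →ₗ[F] F) (f : V →ₗ[F] F) (x : V)
    {u : Fin k → V} (hu : ∀ i, f (u i) = 0) :
    wedgeForm (Fin.cons f g) (Fin.cons x u) = f x * wedgeForm g u := by
  rw [wedgeForm_apply, Matrix.det_succ_column_zero, Fin.sum_univ_succ]
  simp [hu, wedgeForm_apply, Matrix.submatrix]

/-- The spans of the tuples `v` with `v i ∈ D i` on which the form `φ` does not vanish. -/
def nonvanishing {k : ℕ} (D : Fin k → Submodule F V) (φ : V [⋀^Fin k]→ₗ[F] F) :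
    Set (Submodule F V) :=
  {L | ∃ v : Fin k → V, (∀ i, v i ∈ D i) ∧ φ v ≠ 0 ∧ Submodule.span F (Set.range v) = L}

theorem nonvanishing_congr {k : ℕ} {D : Fin k → Submodule F V} {φ ψ : V [⋀^Fin k]→ₗ[F] F}
    (h : ∀ v : Fin k → V, (∀ i, v i ∈ D i) → (φ v = 0 ↔ ψ v = 0)) :
    nonvanishing D φ = nonvanishing D ψ := by
  ext L
  exact exists_congr fun v => and_congr_right fun hv => and_congr_left fun _ =>
    not_congr (h v hv)

theorem nonvanishing_eq_empty {k : ℕ} {D : Fin k → Submodule F V} {φ : V [⋀^Fin k]→ₗ[F] F} :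
    nonvanishing D φ = ∅ ↔ ∀ v : Fin k → V, (∀ i, v i ∈ D i) → φ v = 0 := by
  constructor
  · intro h v hv
    by_contra h0
    have hmem : Submodule.span F (Set.range v) ∈ nonvanishing D φ := ⟨v, hv, h0, rfl⟩
    rw [h] at hmem
    exact hmem
  · rintro h
    ext L
    simp only [Set.mem_empty_iff_false, iff_false]
    rintro ⟨v, hv, h0, -⟩
    exact h0 (h v hv)

theorem span_range_finCons {k : ℕ} (x : V) (u : Fin k → V) :
    Submodule.span F (Set.range (Fin.cons x u : Fin (k + 1) → V)) =
      Submodule.span F (Set.range u) ⊔ Submodule.span F {x} := by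
  rw [Fin.range_cons, Submodule.span_insert, sup_comm]

theorem sup_span_singleton_inf {M B : Submodule F V} {x : V} (hM : M ≤ B) (hx : x ∉ B) :
    (M ⊔ Submodule.span F {x}) ⊓ B = M := by
  rw [sup_inf_assoc_of_le _ hM, sup_eq_left]
  rintro z ⟨hz, hzB⟩
  obtain ⟨a, rfl⟩ := Submodule.mem_span_singleton.1 hz
  by_cases ha : a = 0
  · simp [ha]
  · exact absurd ((B.smul_mem_iff ha).1 hzB) hx

variable {k : ℕ} {D : Fin (k + 1) → Submodule F V} {B : Submodule F V}
  {φ : V [⋀^Fin (k + 1)]→ₗ[F] F}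

theorem span_sup_mem_nonvanishing (hD : ∀ i : Fin k, D i.succ ≤ B) {x : V} (hxA : x ∈ D 0)
    (hxB : x ∉ B) {M : Submodule F V}
    (hM : M ∈ nonvanishing (Fin.tail D) (φ.curryLeft x)) :
    M ⊔ Submodule.span F {x} ∈ nonvanishing D φ ∧ (M ⊔ Submodule.span F {x}) ⊓ B = M := by
  obtain ⟨u, hu, h0, rfl⟩ := hM
  refine ⟨⟨Fin.cons x u, Fin.cases hxA hu, h0, span_range_finCons x u⟩,
    sup_span_singleton_inf (Submodule.span_le.2 ?_) hxB⟩
  rintro _ ⟨i, rfl⟩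
  exact hD i (hu i)

/-- Since `L` is not inside `B` but all later basis vectors are, `v 0 ∉ B` and `L ⊓ B` is the span
of the tail. Writing `x = y + a • v 0` with `y` in that span and `a ≠ 0`, the form at `x` followed
by the tail is `a * φ v`. With the preceding lemma this makes `M ↦ M ⊔ ⟨x⟩` and `L ↦ L ⊓ B` mutually
inverse. -/
theorem inf_mem_nonvanishing (hD : ∀ i : Fin k, D i.succ ≤ B) {L : Submodule F V}
    (hL : L ∈ nonvanishing D φ) {x : V} (hxL : x ∈ L) (hxB : x ∉ B) :
    L ⊓ B ∈ nonvanishing (Fin.tail D) (φ.curryLeft x) ∧ (L ⊓ B) ⊔ Submodule.span F {x} = L ∧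
      finrank F (L ⊓ B : Submodule F V) = k ∧ finrank F L = k + 1 := by
  obtain ⟨v, hv, h0, rfl⟩ := hL
  have hli : LinearIndependent F v := by
    by_contra h
    exact h0 (φ.map_linearDependent v h)
  have hMB : Submodule.span F (Set.range (Fin.tail v)) ≤ B := by
    rw [Submodule.span_le]
    rintro _ ⟨i, rfl⟩
    exact hD i (hv i.succ)
  have hspan : Submodule.span F (Set.range v) =
      Submodule.span F (Set.range (Fin.tail v)) ⊔ Submodule.span F {v 0} := by
    rw [← span_range_finCons, Fin.cons_self_tail]
  have hv0 : v 0 ∉ B := by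
    intro h
    apply hxB
    rw [hspan] at hxL
    exact sup_le hMB ((Submodule.span_singleton_le_iff_mem _ _).2 h) hxL
  have hinf : Submodule.span F (Set.range v) ⊓ B = Submodule.span F (Set.range (Fin.tail v)) := by
    rw [hspan, sup_span_singleton_inf hMB hv0]
  obtain ⟨y, hy, z, hz, rfl⟩ := Submodule.mem_sup.1 (hspan ▸ hxL)
  obtain ⟨a, rfl⟩ := Submodule.mem_span_singleton.1 hz
  have ha : a ≠ 0 := by
    rintro rfl
    exact hxB (by simpa using hMB hy)
  rw [hinf]
  refine ⟨⟨Fin.tail v, fun i => hv i.succ, ?_, rfl⟩, ?_, ?_, ?_⟩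
  · have := φ.cons_add_smul_of_mem_span a (v 0) hy
    rw [Fin.cons_self_tail] at this
    intro h
    exact mul_ne_zero ha h0 (this.symm.trans h)
  · refine le_antisymm (sup_le (Submodule.span_mono ?_)
      ((Submodule.span_singleton_le_iff_mem _ _).2 hxL)) ?_
    · rintro _ ⟨i, rfl⟩
      exact ⟨i.succ, rfl⟩
    · rw [hspan]
      refine sup_le le_sup_left ((Submodule.span_singleton_le_iff_mem _ _).2 ?_)
      have h1 : y + a • v 0 ∈ Submodule.span F (Set.range (Fin.tail v)) ⊔
          Submodule.span F {y + a • v 0} :=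
        Submodule.mem_sup_right (Submodule.mem_span_singleton_self _)
      have h2 := Submodule.sub_mem _ h1 (Submodule.mem_sup_left hy)
      rw [add_sub_cancel_left] at h2
      exact (Submodule.smul_mem_iff _ ha).1 h2
  · have : LinearIndependent F (Fin.tail v) := hli.comp Fin.succ (Fin.succ_injective _)
    simpa using finrank_span_eq_card this
  · simpa using finrank_span_eq_card hli

end Forms

/-! ### Double counting of vectors and detected subspaces. -/

section Counting

variable {F V : Type*} [Field F] [AddCommGroup V] [Module F V] [Module.Finite F V]

theorem Submodule.ncard_eq_pow_finrank (W : Submodule F V) :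
    (W : Set V).ncard = Nat.card F ^ finrank F W := by
  rw [← Module.natCard_eq_pow_finrank (K := F) (V := W)]
  rfl

variable [Finite F]

theorem Submodule.ncard_diff_add (W U : Submodule F V) (h : U ≤ W) :
    ((W : Set V) \ U).ncard + Nat.card F ^ finrank F U = Nat.card F ^ finrank F W := by
  have : Finite V := Module.finite_of_finite F
  rw [← W.ncard_eq_pow_finrank, ← U.ncard_eq_pow_finrank]
  exact Set.ncard_sdiff_add_ncard_of_subset h

/-- Double counting of the pairs `(x, L)` with `x ∈ L ∖ B`. -/
theorem sum_ncard_nonvanishing_curryLeft {k : ℕ} {D : Fin (k + 1) → Submodule F V}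
    {B : Submodule F V} (hD : ∀ i : Fin k, D i.succ ≤ B) (hB : B ≤ D 0)
    (φ : V [⋀^Fin (k + 1)]→ₗ[F] F) :
    ∑ᶠ x ∈ (D 0 : Set V) \ B, (nonvanishing (Fin.tail D) (φ.curryLeft x)).ncard =
      {L ∈ nonvanishing D φ | ¬ L ≤ B}.ncard * (Nat.card F ^ (k + 1) - Nat.card F ^ k) := by
  classical
  have : Finite V := Module.finite_of_finite F
  have : Fintype V := Fintype.ofFinite V
  have : Fintype (Submodule F V) := Fintype.ofFinite _
  have key := Finset.sum_card_bipartiteAbove_eq_sum_card_bipartiteBelow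
    (fun (x : V) (L : Submodule F V) => x ∈ L) (s := ((D 0 : Set V) \ B).toFinset)
    (t := {L ∈ nonvanishing D φ | ¬ L ≤ B}.toFinset)
  have h1 : ∀ x ∈ ((D 0 : Set V) \ B).toFinset,
      (nonvanishing (Fin.tail D) (φ.curryLeft x)).ncard =
      (Finset.bipartiteAbove (fun (x : V) (L : Submodule F V) => x ∈ L)
        {L ∈ nonvanishing D φ | ¬ L ≤ B}.toFinset x).card := by
    intro x hx
    simp only [Set.mem_toFinset, Set.mem_sdiff, SetLike.mem_coe] at hx
    rw [Set.ncard_eq_toFinset_card']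
    refine Finset.card_nbij' (fun M => M ⊔ Submodule.span F {x}) (fun L => L ⊓ B) ?_ ?_ ?_ ?_
    · intro M hM
      have hM' := span_sup_mem_nonvanishing hD hx.1 hx.2 (by simpa using hM)
      have hxs : x ∈ M ⊔ Submodule.span F {x} :=
        Submodule.mem_sup_right (Submodule.mem_span_singleton_self _)
      simp only [Finset.bipartiteAbove, Finset.mem_coe, Finset.mem_filter, Set.mem_toFinset,
        Set.mem_ofPred_eq]
      exact ⟨⟨hM'.1, fun h => hx.2 (h hxs)⟩, hxs⟩
    · intro L hL
      simp only [Finset.bipartiteAbove, Finset.mem_coe, Finset.mem_filter, Set.mem_toFinset,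
        Set.mem_ofPred_eq] at hL
      simpa using (inf_mem_nonvanishing hD hL.1.1 hL.2 hx.2).1
    · intro M hM
      exact (span_sup_mem_nonvanishing hD hx.1 hx.2 (by simpa using hM)).2
    · intro L hL
      simp only [Finset.bipartiteAbove, Finset.mem_coe, Finset.mem_filter, Set.mem_toFinset,
        Set.mem_ofPred_eq] at hL
      exact (inf_mem_nonvanishing hD hL.1.1 hL.2 hx.2).2.1
  have h2 : ∀ L ∈ {L ∈ nonvanishing D φ | ¬ L ≤ B}.toFinset,
      (Finset.bipartiteBelow (fun (x : V) (L : Submodule F V) => x ∈ L)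
        ((D 0 : Set V) \ B).toFinset L).card = Nat.card F ^ (k + 1) - Nat.card F ^ k := by
    intro L hL
    simp only [Set.mem_toFinset, Set.mem_ofPred_eq] at hL
    obtain ⟨x, hxL, hxB⟩ := SetLike.not_le_iff_exists.1 hL.2
    obtain ⟨-, -, h3, h4⟩ := inf_mem_nonvanishing hD hL.1 hxL hxB
    -- Every `L` that is counted meets `B` in dimension exactly `k`, so the fibre size does not
    -- depend on `L`.
    have h5 := Submodule.ncard_diff_add L (L ⊓ B) inf_le_left
    rw [h3, h4] at h5
    rw [← h5, Nat.add_sub_cancel, ← Set.ncard_coe_finset]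
    congr 1
    ext z
    have hLA : L ≤ D 0 := by
      obtain ⟨v, hv, -, rfl⟩ := hL.1
      rw [Submodule.span_le]
      rintro _ ⟨i, rfl⟩
      induction i using Fin.cases with
      | zero => exact hv 0
      | succ i => exact hB (hD i (hv i.succ))
    simp only [Finset.bipartiteBelow, Finset.mem_filter, Set.mem_toFinset,
      Set.mem_sdiff, SetLike.mem_coe, Submodule.mem_inf]
    constructor
    · rintro ⟨⟨-, h⟩, h'⟩
      exact ⟨h', fun h6 => h h6.2⟩
    · rintro ⟨h, h'⟩
      exact ⟨⟨hLA h, fun h6 => h' ⟨h, h6⟩⟩, h⟩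
  rw [Finset.sum_congr rfl h2, Finset.sum_const, smul_eq_mul, ← Finset.sum_congr rfl h1,
    ← Set.ncard_eq_toFinset_card'] at key
  rw [← key]
  exact finsum_mem_eq_toFinset_sum _ _

end Counting

/-! ### Vanishing contractions and minimal forms. -/

section MinimumForms

variable {F V : Type*} [Field F] [AddCommGroup V] [Module F V]

/-- The `x ∈ D 0` for which `φ (x, u₁, …, u_k)` vanishes whenever `u_i ∈ D i` for all `i`. -/
def vanishingSubmodule {k : ℕ} (D : Fin (k + 1) → Submodule F V)
    (φ : V [⋀^Fin (k + 1)]→ₗ[F] F) : Submodule F V where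
  carrier := {x | x ∈ D 0 ∧ ∀ u : Fin k → V, (∀ i, u i ∈ Fin.tail D i) → φ.curryLeft x u = 0}
  add_mem' := fun ⟨hx, hx'⟩ ⟨hy, hy'⟩ => ⟨add_mem hx hy, fun u hu => by
    rw [map_add, AlternatingMap.add_apply, hx' u hu, hy' u hu, add_zero]⟩
  zero_mem' := ⟨zero_mem _, fun u _ => by rw [map_zero, AlternatingMap.zero_apply]⟩
  smul_mem' := fun a _ ⟨hx, hx'⟩ => ⟨Submodule.smul_mem _ a hx, fun u hu => by
    rw [map_smul, AlternatingMap.smul_apply, hx' u hu, smul_zero]⟩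

theorem mem_vanishingSubmodule {k : ℕ} {D : Fin (k + 1) → Submodule F V}
    {φ : V [⋀^Fin (k + 1)]→ₗ[F] F} {x : V} :
    x ∈ vanishingSubmodule D φ ↔
      x ∈ D 0 ∧ nonvanishing (Fin.tail D) (φ.curryLeft x) = ∅ := by
  rw [nonvanishing_eq_empty]
  rfl

theorem vanishingSubmodule_le {k : ℕ} (D : Fin (k + 1) → Submodule F V)
    (φ : V [⋀^Fin (k + 1)]→ₗ[F] F) : vanishingSubmodule D φ ≤ D 0 :=
  fun _ hx => hx.1

theorem vanishingSubmodule_lt {k : ℕ} {D : Fin (k + 1) → Submodule F V}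
    {φ : V [⋀^Fin (k + 1)]→ₗ[F] F} (h : (nonvanishing D φ).Nonempty) :
    vanishingSubmodule D φ < D 0 := by
  obtain ⟨_, v, hv, h0, -⟩ := h
  refine lt_of_le_of_ne (vanishingSubmodule_le D φ) fun he => h0 ?_
  have : v 0 ∈ vanishingSubmodule D φ := he ▸ hv 0
  have := this.2 (Fin.tail v) fun i => hv i.succ
  rwa [AlternatingMap.curryLeft_apply_apply, Matrix.vecCons, Fin.cons_self_tail] at this

/-- A coordinate along `y` on `A`, for `y ∈ A` outside a hyperplane `K` of `A`. -/
theorem exists_dual_of_finrank_add_one [Module.Finite F V] {A K : Submodule F V} (hKA : K ≤ A)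
    (hK : finrank F K + 1 = finrank F A) {y : V} (hyA : y ∈ A) (hyK : y ∉ K) :
    ∃ f : V →ₗ[F] F, f y = 1 ∧ (∀ x ∈ K, f x = 0) ∧ ∀ x ∈ A, x - f x • y ∈ K := by
  obtain ⟨f, hfy, hf⟩ := Submodule.exists_le_ker_of_notMem hyK
  have h1 : ((f y)⁻¹ • f) y = 1 := by simp [hfy]
  have h2 : ∀ x ∈ K, ((f y)⁻¹ • f) x = 0 := fun x hx => by simp [LinearMap.mem_ker.1 (hf hx)]
  refine ⟨(f y)⁻¹ • f, h1, h2, fun x hx => ?_⟩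
  generalize (f y)⁻¹ • f = l at h1 h2
  -- The kernel of `l` cuts `A` in a proper subspace containing the hyperplane `K`, hence in `K`
  -- itself.
  have hlt : A ⊓ LinearMap.ker l < A := by
    refine lt_of_le_of_ne inf_le_left fun he => ?_
    have : y ∈ A ⊓ LinearMap.ker l := he.symm ▸ hyA
    exact one_ne_zero (h1.symm.trans (LinearMap.mem_ker.1 this.2))
  have hle : K ≤ A ⊓ LinearMap.ker l := le_inf hKA h2
  have := Submodule.finrank_lt_finrank_of_lt hlt
  rw [Submodule.eq_of_le_of_finrank_le hle (by omega)]
  exact ⟨sub_mem hx (A.smul_mem _ hyA), by simp [h1]⟩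

/-- If the vanishing submodule of `φ` is a hyperplane of `D 0`, then it contains the smaller
members of the flag. -/
theorem le_vanishingSubmodule [Module.Finite F V] {k : ℕ} {D : Fin (k + 1) → Submodule F V}
    {φ : V [⋀^Fin (k + 1)]→ₗ[F] F} {j : Fin k} (hj : D j.succ ≤ D 0)
    (hK : finrank F (vanishingSubmodule D φ) + 1 = finrank F (D 0)) :
    D j.succ ≤ vanishingSubmodule D φ := by
  intro y hy
  by_contra hyK
  obtain ⟨f, -, -, hf⟩ := exists_dual_of_finrank_add_one (vanishingSubmodule_le D φ) hK (hj hy) hyK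
  refine hyK ⟨hj hy, fun u hu => ?_⟩
  rw [AlternatingMap.curryLeft_apply_apply, Matrix.vecCons]
  have hu' : ∀ i, Function.update u j y i ∈ Fin.tail D i := by
    intro i
    by_cases h : i = j
    · subst h
      rw [Function.update_self]
      exact hy
    · simpa [h] using hu i
  -- Exchange `y` and `u j`: modulo the vanishing submodule `u j` is a multiple of `y`, and `φ` is
  -- zero once `y` fills two slots. So `φ` vanishes on the exchanged tuple, whose value is minus
  -- that of `(y, u)`.
  have h1 := (hf (u j) (hj (hu j))).2 _ hu'
  have h2 : φ.curryLeft y (Function.update u j y) = 0 := by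
    rw [AlternatingMap.curryLeft_apply_apply]
    exact φ.map_eq_zero_of_eq _ (i := 0) (j := j.succ) (by simp) (Fin.succ_ne_zero j).symm
  rw [map_sub, map_smul, AlternatingMap.sub_apply, AlternatingMap.smul_apply, h2, smul_zero,
    sub_zero, AlternatingMap.curryLeft_apply_apply] at h1
  have h3 := φ.map_swap (Fin.cons y u : Fin (k + 1) → V) (Fin.succ_ne_zero j).symm
  rw [← neg_eq_zero, ← h3, ← h1]
  congr 1
  ext i
  refine Fin.cases ?_ (fun i => ?_) i
  · simp
  · by_cases h : i = j
    · subst h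
      simp
    · simp [h, Equiv.swap_apply_of_ne_of_ne (Fin.succ_ne_zero i)
        (fun h' => h (Fin.succ_injective _ h'))]

/-- `d` is the least positive number of spans on which an alternating form on the flag `D` does
not vanish; it is attained by a product of linear forms, and only by forms that are multiples of
such products on `D`. -/
def IsMinNonvanishing {k : ℕ} (D : Fin k → Submodule F V) (d : ℕ) : Prop :=
  0 < d ∧ (∃ g : Fin k → V →ₗ[F] F, (nonvanishing D (wedgeForm g)).ncard = d) ∧
    ∀ φ : V [⋀^Fin k]→ₗ[F] F, (nonvanishing D φ).Nonempty → d ≤ (nonvanishing D φ).ncard ∧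
      ((nonvanishing D φ).ncard = d → ∃ (c : F) (g : Fin k → V →ₗ[F] F),
        ∀ v : Fin k → V, (∀ i, v i ∈ D i) → φ v = c * wedgeForm g v)

theorem isMinNonvanishing_zero (D : Fin 0 → Submodule F V) : IsMinNonvanishing D 1 := by
  have hN : ∀ φ : V [⋀^Fin 0]→ₗ[F] F, (nonvanishing D φ).Nonempty →
      (nonvanishing D φ).ncard = 1 := by
    rintro φ ⟨L, hL⟩
    rw [Set.ncard_eq_one]
    refine ⟨L, Set.eq_singleton_iff_unique_mem.2 ⟨hL, ?_⟩⟩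
    obtain ⟨v, -, -, rfl⟩ := hL
    rintro _ ⟨w, -, -, rfl⟩
    rw [Subsingleton.elim v w]
  have h1 : ∀ (g : Fin 0 → V →ₗ[F] F) v, wedgeForm g v = 1 := fun g v => by
    rw [wedgeForm_apply, Matrix.det_isEmpty]
  refine ⟨one_pos, ⟨Fin.elim0, hN _ ⟨_, Fin.elim0, fun i => i.elim0, ?_, rfl⟩⟩,
    fun φ hφ => ⟨(hN φ hφ).ge, fun _ => ⟨φ Fin.elim0, Fin.elim0, fun v _ => ?_⟩⟩⟩
  · rw [h1]
    exact one_ne_zero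
  · rw [h1, mul_one, Subsingleton.elim v]

variable [Finite F] [Module.Finite F V]

/-- The union has at most `2 q^(a-2) - 1 < q^(a-1)` elements, where `a = dim A`. The common element
`0` supplies the `-1`, which is what keeps the inequality strict for `q = 2`. -/
theorem pow_finrank_lt_ncard_diff_union {A B K : Submodule F V} (hBA : B ≤ A) (hKA : K ≤ A)
    (hB : finrank F B + 2 ≤ finrank F A) (hK : finrank F K + 2 ≤ finrank F A) :
    Nat.card F ^ finrank F A - Nat.card F ^ (finrank F A - 1) <
      ((A : Set V) \ (B ∪ K)).ncard := by
  have : Finite V := Module.finite_of_finite F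
  have hq : 1 < Nat.card F := Finite.one_lt_card
  have h1 := Set.ncard_union_add_ncard_inter (B : Set V) K
  have h2 := Set.ncard_sdiff_add_ncard_of_subset (Set.union_subset hBA hKA : (B ∪ K : Set V) ⊆ A)
  have h3 : 0 < ((B : Set V) ∩ K).ncard :=
    (Set.ncard_pos).2 ⟨0, B.zero_mem, K.zero_mem⟩
  rw [Submodule.ncard_eq_pow_finrank] at h1 h2
  rw [Submodule.ncard_eq_pow_finrank] at h1
  obtain ⟨a, ha⟩ : ∃ a, finrank F A = a + 2 := ⟨_, (Nat.sub_add_cancel (by omega)).symm⟩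
  rw [ha] at hB hK h2 ⊢
  have h4 : Nat.card F ^ finrank F B ≤ Nat.card F ^ a := Nat.pow_le_pow_right hq.le (by omega)
  have h5 : Nat.card F ^ finrank F K ≤ Nat.card F ^ a := Nat.pow_le_pow_right hq.le (by omega)
  have h6 : 2 * Nat.card F ^ a ≤ Nat.card F ^ (a + 1) := by
    rw [pow_succ, mul_comm]
    exact Nat.mul_le_mul_left _ hq
  have h7 : Nat.card F ^ (a + 1) ≤ Nat.card F ^ (a + 2) := Nat.pow_le_pow_right hq.le (by omega)
  rw [show a + 2 - 1 = a + 1 by omega]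
  omega

end MinimumForms

/-! ### Sums of natural numbers bounded below on a subset. -/

section FinsumBounds

variable {α : Type*} [Finite α] {f : α → ℕ} {S T : Set α} {d : ℕ}

theorem ncard_mul_le_finsum_mem (hTS : T ⊆ S) (hd : ∀ x ∈ T, d ≤ f x) :
    T.ncard * d ≤ ∑ᶠ x ∈ S, f x := by
  classical
  have : Fintype α := Fintype.ofFinite α
  rw [finsum_mem_eq_toFinset_sum, Set.ncard_eq_toFinset_card', ← smul_eq_mul]
  exact (Finset.card_nsmul_le_sum _ _ _ fun x hx => hd x (by simpa using hx)).trans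
    (Finset.sum_le_sum_of_subset (Set.toFinset_subset_toFinset.2 hTS))

theorem eq_of_finsum_mem_le (hTS : T ⊆ S) (hd : ∀ x ∈ T, d ≤ f x)
    (h : ∑ᶠ x ∈ S, f x ≤ T.ncard * d) : ∀ x ∈ T, f x = d := by
  classical
  have : Fintype α := Fintype.ofFinite α
  rw [finsum_mem_eq_toFinset_sum, Set.ncard_eq_toFinset_card', ← smul_eq_mul,
    ← Finset.sum_const] at h
  have h1 : ∑ _x ∈ T.toFinset, d = ∑ x ∈ T.toFinset, f x :=
    le_antisymm (Finset.sum_le_sum fun x hx => hd x (by simpa using hx))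
      ((Finset.sum_le_sum_of_subset (Set.toFinset_subset_toFinset.2 hTS)).trans h)
  intro x hx
  exact ((Finset.sum_eq_sum_iff_of_le fun x hx => hd x (by simpa using hx)).1 h1 x
    (by simpa using hx)).symm

theorem finsum_mem_eq_ncard_mul (hTS : T ⊆ S) (hd : ∀ x ∈ T, f x = d)
    (h0 : ∀ x ∈ S, x ∉ T → f x = 0) : ∑ᶠ x ∈ S, f x = T.ncard * d := by
  classical
  have : Fintype α := Fintype.ofFinite α
  rw [finsum_mem_eq_toFinset_sum, Set.ncard_eq_toFinset_card', ← smul_eq_mul,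
    ← Finset.sum_const, ← Finset.sum_subset (Set.toFinset_subset_toFinset.2 hTS)
      fun x hx hx' => h0 x (by simpa using hx) (by simpa using hx')]
  exact Finset.sum_congr rfl fun x hx => hd x (by simpa using hx)

end FinsumBounds

/-! ### The induction along the flag. -/

section MinimumForms

variable {F V : Type*} [Field F] [Finite F] [AddCommGroup V] [Module F V] [Module.Finite F V]
  {k : ℕ} {D : Fin (k + 1) → Submodule F V} {B : Submodule F V}

/-- The number of spans detected by a product of linear forms whose first factor vanishes
on `B`. -/
theorem ncard_nonvanishing_wedgeForm_cons (hD : ∀ i : Fin k, D i.succ ≤ B) (hB : B ≤ D 0)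
    (g : Fin k → V →ₗ[F] F) {f : V →ₗ[F] F} (hf : ∀ x ∈ B, f x = 0) {y : V} (hy : y ∈ D 0)
    (hfy : f y ≠ 0) :
    (nonvanishing D (wedgeForm (Fin.cons f g))).ncard *
        (Nat.card F ^ (k + 1) - Nat.card F ^ k) =
      (Nat.card F ^ finrank F (D 0) - Nat.card F ^ (finrank F (D 0) - 1)) *
        (nonvanishing (Fin.tail D) (wedgeForm g)).ncard := by
  have : Finite V := Module.finite_of_finite F
  have hcons : ∀ x (u : Fin k → V), (∀ i, u i ∈ Fin.tail D i) →
      (wedgeForm (Fin.cons f g)).curryLeft x u = f x * wedgeForm g u := fun x u hu =>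
    wedgeForm_cons g f x fun i => hf _ (hD i (hu i))
  -- No detected subspace lies in `B`, because `f` vanishes there; the double count therefore misses
  -- nothing.
  have hall : {L ∈ nonvanishing D (wedgeForm (Fin.cons f g)) | ¬ L ≤ B} =
      nonvanishing D (wedgeForm (Fin.cons f g)) := by
    refine Set.sep_eq_self_iff_mem_true.2 ?_
    rintro _ ⟨v, hv, h0, rfl⟩ hle
    apply h0
    have h1 := hcons (v 0) (Fin.tail v) fun i => hv i.succ
    rw [AlternatingMap.curryLeft_apply_apply, Matrix.vecCons, Fin.cons_self_tail] at h1
    rw [h1, hf _ (hle (Submodule.subset_span ⟨0, rfl⟩)), zero_mul]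
  rw [← hall, ← sum_ncard_nonvanishing_curryLeft hD hB]
  have hlt : D 0 ⊓ LinearMap.ker f < D 0 :=
    lt_of_le_of_ne inf_le_left fun he => hfy (he.symm ▸ hy : y ∈ D 0 ⊓ LinearMap.ker f).2
  have hrank : finrank F (D 0 ⊓ LinearMap.ker f : Submodule F V) = finrank F (D 0) - 1 := by
    have h1 := Submodule.finrank_lt_finrank_of_lt hlt
    have h2 := Submodule.finrank_sup_add_finrank_inf_eq (D 0) (LinearMap.ker f)
    have h3 := f.finrank_range_add_finrank_ker
    have h4 : finrank F (LinearMap.range f) ≤ 1 := by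
      simpa using Submodule.finrank_le (LinearMap.range f)
    have h5 := Submodule.finrank_le (D 0 ⊔ LinearMap.ker f)
    omega
  have hcard := Submodule.ncard_diff_add (D 0) _ hlt.le
  rw [hrank] at hcard
  rw [← hcard, Nat.add_sub_cancel]
  refine finsum_mem_eq_ncard_mul (Set.sdiff_subset_sdiff_right fun x hx => ⟨hB hx, hf x hx⟩) ?_ ?_
  · rintro x ⟨hx, hx'⟩
    have hfx : f x ≠ 0 := fun h => hx' ⟨hx, h⟩
    rw [nonvanishing_congr (ψ := wedgeForm g) fun u hu => ?_]
    simp [hcons x u hu, hfx]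
  · rintro x ⟨hx, -⟩ hx'
    have hfx : f x = 0 := by
      by_contra h
      exact hx' ⟨hx, fun h' => h h'.2⟩
    rw [Set.ncard_eq_zero, nonvanishing_eq_empty]
    intro u hu
    rw [hcons x u hu, hfx, zero_mul]

/-- The dichotomy is on the codimension of the vanishing submodule `K` in `D 0`. The gap hypothesis
matters only in codimension at least 2; when `K` is a hyperplane, `hBD` is what places `B` inside
it. The alternative `B = ⊥` covers the last member of the flag, on which no gap is imposed. -/
theorem IsMinNonvanishing.cons (hD : ∀ i : Fin k, D i.succ ≤ B) (hB : B < D 0)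
    (hBD : B = ⊥ ∨ ∃ j : Fin k, D j.succ = B) (hgap : B = ⊥ ∨ finrank F B + 2 ≤ finrank F (D 0))
    {d' : ℕ} (h : IsMinNonvanishing (Fin.tail D) d') : ∃ d, IsMinNonvanishing D d := by
  have : Finite V := Module.finite_of_finite F
  have hq : 1 < Nat.card F := Finite.one_lt_card
  obtain ⟨hd', ⟨g, hg⟩, hmin⟩ := h
  obtain ⟨y, hyA, hyB⟩ := SetLike.exists_of_lt hB
  obtain ⟨f, hfy, hfB⟩ := Submodule.exists_le_ker_of_notMem hyB
  -- The candidate minimum `d` satisfies `d (q^(k+1) - q^k) = (q^a - q^(a-1)) d'`.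
  have hd := ncard_nonvanishing_wedgeForm_cons hD hB.le g (fun x hx => hfB hx) hyA hfy
  rw [hg] at hd
  set d := (nonvanishing D (wedgeForm (Fin.cons f g))).ncard with hd_def
  set a := finrank F (D 0) with ha_def
  have ha : 0 < a := lt_of_le_of_lt (Nat.zero_le _) (Submodule.finrank_lt_finrank_of_lt hB)
  have hA : 0 < Nat.card F ^ a - Nat.card F ^ (a - 1) :=
    Nat.sub_pos_of_lt (Nat.pow_lt_pow_right hq (by omega))
  have hQ : 0 < Nat.card F ^ (k + 1) - Nat.card F ^ k :=
    Nat.sub_pos_of_lt (Nat.pow_lt_pow_right hq (by omega))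
  refine ⟨d, Nat.pos_of_mul_pos_right (hd ▸ Nat.mul_pos hA hd'), ⟨_, rfl⟩, fun φ hφ => ?_⟩
  set K := vanishingSubmodule D φ with hK_def
  have hKA : K ≤ D 0 := vanishingSubmodule_le D φ
  have hKlt : finrank F K < a := Submodule.finrank_lt_finrank_of_lt (vanishingSubmodule_lt hφ)
  have hsum := sum_ncard_nonvanishing_curryLeft hD hB.le φ
  have hsub : {L ∈ nonvanishing D φ | ¬ L ≤ B}.ncard ≤ (nonvanishing D φ).ncard :=
    Set.ncard_le_ncard (Set.sep_subset _ _)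
  have hTS : ((D 0 : Set V) \ (B ∪ K)) ⊆ (D 0 : Set V) \ B :=
    Set.sdiff_subset_sdiff_right Set.subset_union_left
  have hnonempty : ∀ x ∈ (D 0 : Set V) \ (B ∪ K),
      (nonvanishing (Fin.tail D) (φ.curryLeft x)).Nonempty := by
    rintro x ⟨hx, hx'⟩
    rw [Set.nonempty_iff_ne_empty]
    exact fun he => hx' (Or.inr (mem_vanishingSubmodule.2 ⟨hx, he⟩))
  have hlower : ∀ x ∈ (D 0 : Set V) \ (B ∪ K),
      d' ≤ (nonvanishing (Fin.tail D) (φ.curryLeft x)).ncard :=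
    fun x hx => (hmin _ (hnonempty x hx)).1
  have hle := ncard_mul_le_finsum_mem hTS hlower
  rw [hsum] at hle
  rcases Nat.lt_or_ge (finrank F K + 1) a with hK | hK
  · have hBr : finrank F B + 2 ≤ a := by
      rcases hgap with rfl | hgap
      · rw [finrank_bot]
        omega
      · exact hgap
    have hlt := pow_finrank_lt_ncard_diff_union hB.le hKA hBr hK
    have h1 := (Nat.mul_lt_mul_of_pos_right hlt hd').trans_le hle
    rw [← ha_def, ← hd] at h1
    have h2 := Nat.lt_of_mul_lt_mul_right h1
    -- The count strictly exceeds `d`, so the equality case is void.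
    exact ⟨by omega, by omega⟩
  · have hK1 : finrank F K + 1 = a := by omega
    have hBK : B ≤ K := by
      rcases hBD with rfl | ⟨j, rfl⟩
      · exact bot_le
      · exact le_vanishingSubmodule hB.le hK1
    have hcard := Submodule.ncard_diff_add (D 0) K hKA
    rw [Set.union_eq_self_of_subset_left (show (B : Set V) ⊆ K from hBK)] at hle hlower hTS
    rw [← ha_def, show finrank F K = a - 1 by omega] at hcard
    have hcard' : ((D 0 : Set V) \ K).ncard = Nat.card F ^ a - Nat.card F ^ (a - 1) := by omega
    rw [hcard', ← hd] at hle
    have h1 := Nat.le_of_mul_le_mul_right hle hQ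
    refine ⟨h1.trans hsub, fun heq => ?_⟩
    -- Equality leaves no slack in the sum: each `x` outside `K` has a contraction attaining `d'`.
    have h2 := eq_of_finsum_mem_le hTS hlower (by
      rw [hsum, hcard', ← hd]
      exact Nat.mul_le_mul_right _ (hsub.trans heq.le))
    obtain ⟨z, hzA, hzK⟩ := SetLike.exists_of_lt (vanishingSubmodule_lt hφ)
    have hz : (nonvanishing (Fin.tail D) (φ.curryLeft z)).Nonempty :=
      hnonempty z ⟨hzA, fun h => h.elim (fun h => hzK (hBK h)) hzK⟩
    obtain ⟨c, g', hg'⟩ := (hmin _ hz).2 (h2 z ⟨hzA, hzK⟩)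
    obtain ⟨l, -, hlK, hl⟩ := exists_dual_of_finrank_add_one hKA hK1 hzA hzK
    refine ⟨c, Fin.cons l g', fun v hv => ?_⟩
    have hv' : ∀ i, Fin.tail v i ∈ Fin.tail D i := fun i => hv i.succ
    have h3 := wedgeForm_cons g' l (v 0) (u := Fin.tail v)
      fun i => hlK _ (hBK (hD i (hv' i)))
    -- Since `v 0 - l (v 0) • z ∈ K`, the contraction by `v 0` is `l (v 0)` times the one by `z` on
    -- the tail, where `l` vanishes.
    have h4 := (hl (v 0) (hv 0)).2 (Fin.tail v) hv'
    rw [map_sub, map_smul, AlternatingMap.sub_apply, AlternatingMap.smul_apply, hg' _ hv',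
      AlternatingMap.curryLeft_apply_apply, Matrix.vecCons, Fin.cons_self_tail, smul_eq_mul,
      sub_eq_zero] at h4
    rw [Fin.cons_self_tail] at h3
    rw [h3, h4]
    ring

theorem exists_isMinNonvanishing : ∀ {k : ℕ} (D : Fin k → Submodule F V), StrictAnti D →
    (∀ i, D i ≠ ⊥) →
    (∀ i j : Fin k, (j : ℕ) = i + 1 → finrank F (D j) + 2 ≤ finrank F (D i)) →
    ∃ d, IsMinNonvanishing D d
  | 0, D, _, _, _ => ⟨1, isMinNonvanishing_zero D⟩
  | 1, D, _, hne, _ => by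
    refine IsMinNonvanishing.cons (B := ⊥) (fun i => i.elim0) (bot_lt_iff_ne_bot.2 (hne 0))
      (Or.inl rfl) (Or.inl rfl) (isMinNonvanishing_zero (Fin.tail D))
  | k + 2, D, hanti, hne, hgap => by
    obtain ⟨d', hd'⟩ := exists_isMinNonvanishing (Fin.tail D)
      (fun i j hij => hanti (Fin.succ_lt_succ_iff.2 hij)) (fun i => hne i.succ)
      (fun i j hij => hgap i.succ j.succ (by simp [hij]))
    exact IsMinNonvanishing.cons (B := D 1)
      (fun i => hanti.antitone (Fin.one_le_of_ne_zero (Fin.succ_ne_zero i)))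
      (hanti Fin.zero_lt_one) (Or.inr ⟨0, rfl⟩) (Or.inr (hgap 0 1 (by simp))) hd'

end MinimumForms

/-! ### Products of linear forms as forms of decomposable elements. -/

section DualForms

variable {F V : Type*} [Field F] [AddCommGroup V] [Module F V] {ℓ m : ℕ}

/-- An alternating form does not change when its arguments move by elements that it kills. -/
theorem AlternatingMap.congr_of_sub_mem (φ : V [⋀^Fin ℓ]→ₗ[F] F) {W : Submodule F V}
    (hW : ∀ (v : Fin ℓ → V) (i : Fin ℓ), v i ∈ W → φ v = 0) {u v : Fin ℓ → V}
    (h : ∀ i, u i - v i ∈ W) : φ u = φ v := by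
  have huv : u = v + (u - v) := (add_sub_cancel v u).symm
  -- In the multilinear expansion of `φ (v + (u - v))`, every term other than `φ v` has an argument
  -- in `W`.
  rw [huv, ← AlternatingMap.coe_multilinearMap, MultilinearMap.map_add_univ,
    Finset.sum_eq_single Finset.univ]
  · simp
  · intro s _ hs
    obtain ⟨i, hi⟩ := not_forall.1 fun h' => hs (Finset.eq_univ_iff_forall.2 h')
    refine hW _ i ?_
    rw [Finset.piecewise_eq_of_notMem _ _ _ hi]
    exact h i
  · simp

/-- An alternating `ℓ`-form killed by the common kernel of `ℓ` independent linear forms is a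
multiple of their product. -/
theorem AlternatingMap.eq_smul_wedgeForm (φ : V [⋀^Fin ℓ]→ₗ[F] F) (g : Fin ℓ → V →ₗ[F] F)
    (hφ : ∀ (v : Fin ℓ → V) (i : Fin ℓ), v i ∈ LinearMap.ker (LinearMap.pi g) → φ v = 0)
    {T : (Fin ℓ → F) →ₗ[F] V} (hT : LinearMap.pi g ∘ₗ T = LinearMap.id) :
    φ = φ (fun i => T (Pi.basisFun F (Fin ℓ) i)) • wedgeForm g := by
  ext v
  have h1 := DFunLike.congr_fun (AlternatingMap.eq_smul_basis_det (Pi.basisFun F (Fin ℓ))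
    (φ.compLinearMap T)) fun i => LinearMap.pi g (v i)
  have h2 : φ v = φ.compLinearMap T fun i => LinearMap.pi g (v i) := by
    rw [AlternatingMap.compLinearMap_apply]
    refine φ.congr_of_sub_mem hφ fun i => ?_
    rw [LinearMap.mem_ker, map_sub, sub_eq_zero]
    exact (LinearMap.congr_fun hT _).symm
  rw [h2, h1, Pi.basisFun_det]
  rfl

theorem range_pi_eq_top_of_wedgeForm_ne_zero {g : Fin ℓ → V →ₗ[F] F} {v : Fin ℓ → V}
    (h : wedgeForm g v ≠ 0) : LinearMap.range (LinearMap.pi g) = ⊤ := by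
  have hli : LinearIndependent F fun i => LinearMap.pi g (v i) := by
    by_contra hli
    exact h (Matrix.detRowAlternating.map_linearDependent _ hli)
  have h1 := hli.span_eq_top_of_card_eq_finrank' (by simp)
  rw [eq_top_iff, ← h1, Submodule.span_le]
  rintro _ ⟨i, rfl⟩
  exact ⟨v i, rfl⟩

/-- The alternating form `(u₁, …, u_ℓ) ↦ f ∧ u₁ ∧ ⋯ ∧ u_ℓ` of `f ∈ ⋀^(m-ℓ) V`. -/
noncomputable def complementaryForm (h : ℓ ≤ m) (b : Basis (Fin m) F V) (f : ⋀[F]^(m - ℓ) V) :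
    V [⋀^Fin ℓ]→ₗ[F] F :=
  LinearMap.compAlternatingMap
    { toFun := fun P => topIdentification b (wedgeRight h P f)
      map_add' := fun P Q => by
        rw [← map_add]
        congr 1
        ext
        simp [wedgeRight, mul_add]
      map_smul' := fun a P => by
        rw [RingHom.id_apply, ← map_smul]
        congr 1
        ext
        simp [wedgeRight] }
    (exteriorPower.ιMulti F ℓ)

theorem complementaryForm_apply (h : ℓ ≤ m) (b : Basis (Fin m) F V) (f : ⋀[F]^(m - ℓ) V)
    (u : Fin ℓ → V) :
    complementaryForm h b f u =
      topIdentification b (wedgeRight h (exteriorPower.ιMulti F ℓ u) f) := rfl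

theorem complementaryForm_smul (h : ℓ ≤ m) (b : Basis (Fin m) F V) (a : F)
    (f : ⋀[F]^(m - ℓ) V) :
    complementaryForm h b (a • f) = a • complementaryForm h b f := by
  ext u
  rw [AlternatingMap.smul_apply, complementaryForm_apply, complementaryForm_apply, map_smul,
    map_smul]

theorem complementaryForm_ιMulti (h : ℓ ≤ m) (b : Basis (Fin m) F V) (w : Fin (m - ℓ) → V)
    (u : Fin ℓ → V) :
    complementaryForm h b (exteriorPower.ιMulti F (m - ℓ) w) u =
      b.det (Fin.append w u ∘ Fin.cast (Nat.sub_add_cancel h).symm) := by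
  rw [complementaryForm_apply]
  have : wedgeRight h (exteriorPower.ιMulti F ℓ u) (exteriorPower.ιMulti F (m - ℓ) w) =
      exteriorPower.ιMulti F m (Fin.append w u ∘ Fin.cast (Nat.sub_add_cancel h).symm) := by
    ext
    simp only [wedgeRight, LinearMap.coe_mk, AddHom.coe_mk, exteriorPower.ιMulti_apply_coe,
      ExteriorAlgebra.ιMulti_apply]
    rw [← List.prod_append, ← List.ofFn_fin_append, List.ofFn_congr (Nat.sub_add_cancel h)]
    congr 2
    ext i
    simp only [Function.comp_apply]
    generalize Fin.cast _ i = j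
    refine Fin.addCases (fun j => ?_) (fun j => ?_) j <;> simp
  rw [this, topIdentification, exteriorPower.alternatingMapLinearEquiv_apply_ιMulti]

theorem IsDecomposable.smul {d : ℕ} (hd : 0 < d) {f : ⋀[F]^d V} (hf : IsDecomposable f) {a : F}
    (ha : a ≠ 0) : IsDecomposable (a • f) := by
  obtain ⟨h0, v, rfl⟩ := hf
  refine ⟨smul_ne_zero ha h0, Function.update v ⟨0, hd⟩ (a • v ⟨0, hd⟩), ?_⟩
  rw [AlternatingMap.map_update_smul, Function.update_eq_self]

/-- A nonzero multiple of a nonzero product of linear forms is the form of a decomposable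
element. -/
theorem exists_isDecomposable_complementaryForm_eq (h : ℓ < m) (b : Basis (Fin m) F V)
    (g : Fin ℓ → V →ₗ[F] F) {v : Fin ℓ → V} (hv : wedgeForm g v ≠ 0) {c : F} (hc : c ≠ 0) :
    ∃ f : ⋀[F]^(m - ℓ) V, IsDecomposable f ∧ complementaryForm h.le b f = c • wedgeForm g := by
  have : Module.Finite F V := Module.Finite.of_basis b
  have hrange := range_pi_eq_top_of_wedgeForm_ne_zero hv
  obtain ⟨T, hT⟩ := (LinearMap.pi g).exists_rightInverse_of_surjective hrange
  have hker : finrank F (LinearMap.ker (LinearMap.pi g)) = m - ℓ := by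
    have h1 := (LinearMap.pi g).finrank_range_add_finrank_ker
    rw [hrange, finrank_top, finrank_fin_fun, finrank_eq_card_basis b, Fintype.card_fin] at h1
    omega
  obtain ⟨w⟩ : Nonempty (Basis (Fin (m - ℓ)) F (LinearMap.ker (LinearMap.pi g))) :=
    ⟨finBasisOfFinrankEq F _ hker⟩
  obtain ⟨w', hw'⟩ : ∃ w' : Fin (m - ℓ) → V, w' = Subtype.val ∘ w := ⟨_, rfl⟩
  obtain ⟨e, he⟩ : ∃ e : Fin ℓ → V, e = T ∘ Pi.basisFun F (Fin ℓ) := ⟨_, rfl⟩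
  have hspanw : Submodule.span F (Set.range w') = LinearMap.ker (LinearMap.pi g) := by
    have h1 := congrArg (Submodule.map (LinearMap.ker (LinearMap.pi g)).subtype) w.span_eq
    rw [Submodule.map_span, Submodule.map_top, Submodule.range_subtype, ← Set.range_comp] at h1
    rw [hw']
    exact h1
  have hTinj : Function.Injective T := fun x y hxy => by
    have h1 := LinearMap.congr_fun hT x
    have h2 := LinearMap.congr_fun hT y
    simp only [LinearMap.comp_apply, hxy, LinearMap.id_apply] at h1 h2
    exact h1.symm.trans h2
  have hli : LinearIndependent F (Sum.elim w' e) := by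
    refine LinearIndependent.sum_type ?_ ?_ ?_
    · rw [hw']
      exact w.linearIndependent.map' _ (Submodule.ker_subtype _)
    · rw [he]
      exact (Pi.basisFun F (Fin ℓ)).linearIndependent.map' T (LinearMap.ker_eq_bot.2 hTinj)
    · rw [hspanw, Submodule.disjoint_def]
      intro x hx hx'
      have h1 : Submodule.span F (Set.range e) ≤ LinearMap.range T := by
        rw [Submodule.span_le]
        rintro _ ⟨i, rfl⟩
        rw [he]
        exact ⟨Pi.basisFun F (Fin ℓ) i, rfl⟩
      obtain ⟨z, rfl⟩ := h1 hx'
      have h2 := LinearMap.congr_fun hT z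
      rw [LinearMap.comp_apply, LinearMap.mem_ker.1 hx] at h2
      rw [show z = 0 from h2.symm, map_zero]
  obtain ⟨η, hηdef⟩ : ∃ η, η = complementaryForm h.le b (exteriorPower.ιMulti F (m - ℓ) w') :=
    ⟨_, rfl⟩
  -- A vector of the common kernel is a combination of the `w'`, so appending it makes the
  -- determinant vanish.
  have hη : ∀ (u : Fin ℓ → V) (i : Fin ℓ), u i ∈ LinearMap.ker (LinearMap.pi g) → η u = 0 := by
    intro u i hi
    rw [hηdef, complementaryForm_ιMulti]
    apply AlternatingMap.map_linearDependent
    intro hli'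
    have h1 : LinearIndependent F (Fin.append w' u) := by
      have := hli'.comp (Fin.cast (Nat.sub_add_cancel h.le)) (Fin.cast_injective _)
      exact this
    have h2 := h1.notMem_span_image (s := Set.range (Fin.castAdd ℓ)) (x := Fin.natAdd _ i) (by
      rintro ⟨j, hj⟩
      have := congrArg Fin.val hj
      simp only [Fin.val_castAdd, Fin.val_natAdd] at this
      omega)
    rw [← Set.range_comp, Fin.append_right] at h2
    have h3 : Fin.append w' u ∘ Fin.castAdd ℓ = w' := by
      ext j
      simp
    rw [h3, hspanw] at h2
    exact h2 hi
  have hηe : η e ≠ 0 := by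
    rw [hηdef, complementaryForm_ιMulti]
    have h1 : LinearIndependent F
        (Fin.append w' e ∘ Fin.cast (Nat.sub_add_cancel h.le).symm) := by
      have h2 : Fin.append w' e = Sum.elim w' e ∘ finSumFinEquiv.symm := by
        ext j
        refine Fin.addCases (fun j => ?_) (fun j => ?_) j <;> simp
      rw [h2]
      exact (hli.comp _ finSumFinEquiv.symm.injective).comp _ (Fin.cast_injective _)
    exact (b.is_basis_iff_det.1 ⟨h1, h1.span_eq_top_of_card_eq_finrank'
      (finrank_eq_card_basis b).symm⟩).ne_zero
  have hηg : η = η e • wedgeForm g := he ▸ η.eq_smul_wedgeForm g hη hT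
  -- The scalar can be absorbed into one factor because `m - ℓ > 0`.
  refine ⟨(c * (η e)⁻¹) • exteriorPower.ιMulti F (m - ℓ) w', IsDecomposable.smul (by omega)
    ⟨fun h0 => hηe ?_, w', rfl⟩ (mul_ne_zero hc (inv_ne_zero hηe)), ?_⟩
  · simp [hηdef, h0, complementaryForm_apply]
  · rw [complementaryForm_smul, ← hηdef]
    generalize η e = r at hηe hηg
    rw [hηg, smul_smul, inv_mul_cancel_right₀ hηe]

end DualForms

/-! ### Weights of codewords as numbers of detected subspaces. -/

section SchubertCode

variable {F V : Type*} [Field F] [AddCommGroup V] [Module F V] {ℓ m n : ℕ}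

theorem mem_wedgeAnnihilator_ιMulti (u : Fin ℓ → V) (i : Fin ℓ) :
    u i ∈ wedgeAnnihilator (exteriorPower.ιMulti F ℓ u) := by
  rw [wedgeAnnihilator, LinearMap.mem_ker, LinearMap.comp_apply, LinearMap.mulLeft_apply,
    exteriorPower.ιMulti_apply_coe]
  have h1 : ExteriorAlgebra.ιMulti F ℓ u * ExteriorAlgebra.ι F (u i) =
      ExteriorAlgebra.ιMulti F (ℓ + 1) (Fin.snoc u (u i) : Fin (ℓ + 1) → V) := by
    rw [ExteriorAlgebra.ιMulti_apply, ExteriorAlgebra.ιMulti_apply, List.ofFn_succ', List.prod_concat]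
    simp
  rw [h1]
  exact AlternatingMap.map_eq_zero_of_eq _ _ (i := i.castSucc) (j := Fin.last ℓ) (by simp)
    (Fin.castSucc_lt_last i).ne

/-- The factors of `P` annihilate it and are independent as `P ≠ 0`; their span lies in `L` and has
the same dimension. -/
theorem IsSchubertRepresentative.exists_span_eq [Module.Finite F V] {A : Fin ℓ → Submodule F V}
    {L : Submodule F V} {P : ⋀[F]^ℓ V} (h : IsSchubertRepresentative A L P)
    (hL : finrank F L = ℓ) :
    ∃ u : Fin ℓ → V, (∀ i, u i ∈ A i.rev) ∧ P = exteriorPower.ιMulti F ℓ u ∧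
      Submodule.span F (Set.range u) = L := by
  obtain ⟨h0, ⟨v, hv, rfl⟩, rfl⟩ := h
  refine ⟨fun i => v i.rev, fun i => hv i.rev, rfl, ?_⟩
  have hli : LinearIndependent F fun i : Fin ℓ => v i.rev := by
    by_contra hli
    exact h0 (AlternatingMap.map_linearDependent _ _ hli)
  refine Submodule.eq_of_le_of_finrank_eq (Submodule.span_le.2 ?_) ?_
  · rintro _ ⟨i, rfl⟩
    exact mem_wedgeAnnihilator_ιMulti (fun i : Fin ℓ => v i.rev) i
  · rw [hL, finrank_span_eq_card hli, Fintype.card_fin]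

theorem span_mem_schubertVariety [Module.Finite F V] {A : Fin ℓ → Submodule F V}
    (hA : Monotone A) {u : Fin ℓ → V} (hu : ∀ i, u i ∈ A i.rev) (hli : LinearIndependent F u) :
    Submodule.span F (Set.range u) ∈ schubertVariety A := by
  refine ⟨by rw [finrank_span_eq_card hli, Fintype.card_fin], fun i => ?_⟩
  -- The last `i + 1` vectors of `u` lie in `A 0, …, A i`, hence all in `A i`.
  let w : Fin (i + 1) → V := fun j => u (Fin.rev (Fin.castLE i.2 j))
  have hw : LinearIndependent F w :=
    hli.comp _ (Fin.rev_injective.comp (Fin.castLE_injective i.2))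
  have hle : Submodule.span F (Set.range w) ≤ Submodule.span F (Set.range u) ⊓ A i := by
    rw [Submodule.span_le]
    rintro _ ⟨j, rfl⟩
    refine ⟨Submodule.subset_span ⟨_, rfl⟩, ?_⟩
    have h1 := hu (Fin.rev (Fin.castLE i.2 j))
    rw [Fin.rev_rev] at h1
    exact hA (Fin.le_def.2 (Nat.lt_succ_iff.1 j.2)) h1
  calc (i : ℕ) + 1 = finrank F (Submodule.span F (Set.range w)) := by
        rw [finrank_span_eq_card hw, Fintype.card_fin]
    _ ≤ _ := Submodule.finrank_mono hle

/-- The weight of the codeword of `f` counts the points at which the form of `f` does not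
vanish. -/
theorem hammingNorm_schubertEval [DecidableEq F] (h : ℓ ≤ m) (b : Basis (Fin m) F V)
    {A : Fin ℓ → Submodule F V} (hA : Monotone A) (L : Fin n ≃ schubertVariety A)
    {P : Fin n → ⋀[F]^ℓ V} (hP : ∀ j, IsSchubertRepresentative A (L j : Submodule F V) (P j))
    (f : ⋀[F]^(m - ℓ) V) :
    hammingNorm (schubertEval h b P f) =
      (nonvanishing (fun i => A i.rev) (complementaryForm h b f)).ncard := by
  have : Module.Finite F V := Module.Finite.of_basis b
  choose u hu hPu hspan using fun j => (hP j).exists_span_eq (L j).2.1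
  have hval : ∀ j, schubertEval h b P f j = complementaryForm h b f (u j) := fun j => by
    rw [complementaryForm_apply, ← hPu j]
    rfl
  rw [hammingNorm, ← Set.ncard_coe_finset]
  refine Set.ncard_congr (fun j _ => (L j : Submodule F V)) ?_ ?_ ?_
  · intro j hj
    refine ⟨u j, hu j, ?_, hspan j⟩
    rw [← hval]
    simpa using hj
  · intro i j _ _ hij
    exact L.injective (Subtype.ext hij)
  · rintro _ ⟨v, hv, h0, rfl⟩
    have hli : LinearIndependent F v := by
      by_contra hli
      exact h0 (AlternatingMap.map_linearDependent _ _ hli)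
    refine ⟨L.symm ⟨_, span_mem_schubertVariety hA hv hli⟩, ?_, by simp⟩
    simp only [Finset.coe_filter, Finset.mem_univ, true_and, Set.mem_ofPred_eq, ne_eq, hval]
    intro h1
    -- Both `v` and the chosen factors of the representative span the same subspace, so vanishing on
    -- the latter would force vanishing on `v`.
    refine h0 (AlternatingMap.eq_zero_of_mem_span_range _ (fun i => ?_) h1)
    rw [hspan, Equiv.apply_symm_apply]
    exact Submodule.subset_span ⟨i, rfl⟩

end SchubertCode

/-- `F` is the finite field, `V` is an `F`-vector space of dimension `m` with a basis `b` that
identifies `⋀^m V` with `F`, `A` is the partial flag with dimension sequence `α`, the subspaces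
`L 0, …, L (n - 1)` enumerate the Schubert variety, and the `P j` are the chosen representatives. -/
theorem theorem6p1 {F V : Type*} [Field F] [Finite F] [DecidableEq F]
    [AddCommGroup V] [Module F V] {ℓ m n : ℕ} (hℓ : 1 ≤ ℓ) (hℓm : ℓ < m)
    (b : Module.Basis (Fin m) F V)
    (A : Fin ℓ → Submodule F V) (hA : IsPartialFlag A)
    (hα : CompletelyNonConsecutive (dimSeq A))
    (L : Fin n ≃ schubertVariety A)
    (P : Fin n → ⋀[F]^ℓ V) (hP : ∀ j, IsSchubertRepresentative A (L j : Submodule F V) (P j))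
    (c : Fin n → F) (hc : IsMinWeightCodeword (schubertCode hℓm.le b P) c) :
    ∃ h : ⋀[F]^(m - ℓ) V, IsDecomposable h ∧ c = schubertEval hℓm.le b P h := by
  have : Module.Finite F V := Module.Finite.of_basis b
  have : Finite V := Module.finite_of_finite F
  have hmono : Monotone A := hA.1.monotone
  have hweight := hammingNorm_schubertEval hℓm.le b hmono L hP
  obtain ⟨d, hd, ⟨g, hg⟩, hmin⟩ := exists_isMinNonvanishing (fun i => A i.rev)
    (fun i j hij => hA.1 (Fin.rev_lt_rev.2 hij)) (fun i => hA.2 _)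
    (fun i j hij => hα j.rev i.rev (by simp only [Fin.val_rev]; omega))
  obtain ⟨_, v, hv, hgv, -⟩ := Set.nonempty_of_ncard_ne_zero (hg.trans_ne hd.ne')
  obtain ⟨h₀, -, hh₀⟩ := exists_isDecomposable_complementaryForm_eq hℓm b g hgv one_ne_zero
  rw [one_smul] at hh₀
  have hw₀ : hammingNorm (schubertEval hℓm.le b P h₀) = d := by rw [hweight, hh₀, hg]
  have hmem₀ : d ∈ {w : ℕ | ∃ c ∈ schubertCode hℓm.le b P, c ≠ 0 ∧ hammingNorm c = w} :=
    ⟨_, ⟨h₀, rfl⟩, fun h => hd.ne' (by rw [← hw₀, h, hammingNorm_zero]), hw₀⟩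
  obtain ⟨⟨f, rfl⟩, hcw⟩ := hc
  have hle : hammingNorm (schubertEval hℓm.le b P f) ≤ d := hcw.trans_le (Nat.sInf_le hmem₀)
  have hpos : 0 < hammingNorm (schubertEval hℓm.le b P f) := by
    -- The infimum is over a nonempty set, hence is the weight of a nonzero word and not the default
    -- `sInf ∅ = 0`; this excludes the zero codeword.
    obtain ⟨c', -, hc', hcw'⟩ := Nat.sInf_mem ⟨d, hmem₀⟩
    rw [hcw, minDistance, ← hcw']
    exact hammingNorm_pos_iff.2 hc'
  rw [hweight] at hle hpos
  have hne := Set.nonempty_of_ncard_ne_zero hpos.ne'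
  obtain ⟨hge, heq⟩ := hmin _ hne
  obtain ⟨a, g', hag⟩ := heq (le_antisymm hle hge)
  obtain ⟨_, w, hw, h0, -⟩ := hne
  rw [hag w hw] at h0
  obtain ⟨h, hdec, hform⟩ := exists_isDecomposable_complementaryForm_eq hℓm b g'
    (right_ne_zero_of_mul h0) (left_ne_zero_of_mul h0)
  -- Only the codewords of `f` and `h` must agree: their forms coincide on flag tuples, although `f`
  -- itself need not be decomposable.
  refine ⟨h, hdec, funext fun j => ?_⟩
  obtain ⟨u, hu, hPu, -⟩ := (hP j).exists_span_eq (L j).2.1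
  have hval : ∀ f, schubertEval hℓm.le b P f j = complementaryForm hℓm.le b f u := fun f => by
    rw [complementaryForm_apply, ← hPu]
    rfl
  rw [hval, hval, hform, hag u hu]
  rfl
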